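/- For a polynomial relation in one generator $x$ and its adjoint $x^*$ that bounds the norm of the generator in all of its representations by bounded operators on Hilbert spaces, the universal unital C*-algebra of the relation is the completion, modulo the null space, of the algebra of noncommutative polynomials $a$ in $x, x^*$ under the seminorm $\|a\|=\sup_\pi\|\pi(a)\|$, where $\pi$ runs over all representations of the relation on complex Hilbert spaces. For $0<\mu<1$ let $C(\mathbb{D}_\mu)$ be the universal unital C*-algebra generated by $z$ and $\bar z=z^*$ with the relation $$[\bar z,z]=\mu\,(I-z\bar z)(I-\bar z z),$$ and let the Toeplitz algebra $\mathfrak{T}$ be the universal unital C*-algebra generated by one element $U$ with the relation $U^*U=I$. Corollary. The C*-algebras $C(\mathbb{D}_\mu)$, $0<\mu<1$, are all *-isomorphic to each other, and $C(\mathbb{D}_\mu)\cong\mathfrak{T}$ (as unital C*-algebras) for every $\mu$ with $0<\mu<1$. -/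

import Mathlib

open scoped ENNReal

noncomputable section

namespace QuantumDisk

/-! ### Universal unital C*-algebras on one generator and its adjoint -/

/-- Noncommutative polynomials in two letters `z` and `z̄`. -/
abbrev StarPoly : Type := FreeAlgebra ℂ Bool

/-- The letter `z`. -/
def StarPoly.z : StarPoly := FreeAlgebra.ι ℂ false

/-- The letter `z̄`. -/
def StarPoly.zbar : StarPoly := FreeAlgebra.ι ℂ true

/-- Evaluation of a polynomial in `z, z̄` at an element `x` of a unital *-algebra: the algebra
homomorphism with `z ↦ x` and `z̄ ↦ x*`. -/
def StarPoly.eval {A : Type*} [Ring A] [StarRing A] [Algebra ℂ A] (x : A) : StarPoly →ₐ[ℂ] A :=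
  FreeAlgebra.lift ℂ (fun b => bif b then star x else x)

section eval

variable {A : Type*} [Ring A] [StarRing A] [Algebra ℂ A] (x : A)

@[simp] theorem StarPoly.eval_z : StarPoly.eval x StarPoly.z = x := by
  simp [StarPoly.eval, StarPoly.z]

@[simp] theorem StarPoly.eval_zbar : StarPoly.eval x StarPoly.zbar = star x := by
  simp [StarPoly.eval, StarPoly.zbar]

end eval

/-- A representation of the relation `p(z, z̄) = 0` on a Hilbert space: a nonzero complex Hilbert
space and a bounded operator `T` on it with `p(T, T*) = 0`. (The zero space is left out only
because it contributes nothing to a supremum of norms.) -/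
structure HilbertRep (p : StarPoly) where
  /-- the Hilbert space -/
  H : Type
  [normed : NormedAddCommGroup H]
  [inner : InnerProductSpace ℂ H]
  [complete : CompleteSpace H]
  [nontrivial : Nontrivial H]
  /-- the operator that represents `z` -/
  op : H →L[ℂ] H
  /-- the relation holds -/
  rel : StarPoly.eval op p = 0

attribute [instance] HilbertRep.normed HilbertRep.inner HilbertRep.complete HilbertRep.nontrivial

/-- The relation `p = 0` bounds the norm of the generator in all representations; this is what is
needed for the supremum of the norms over all representations to be finite. -/
def IsBoundedRel (p : StarPoly) : Prop :=
  ∃ C : ℝ, ∀ ρ : HilbertRep p, ‖ρ.op‖ ≤ C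

/-- The C*-algebra of all bounded families `(a_ρ)`, `a_ρ` a bounded operator on the space of `ρ`,
indexed by all representations `ρ`, with pointwise operations and the supremum norm. -/
def RepProduct (p : StarPoly) : Type 1 :=
  lp (fun ρ : HilbertRep p => ρ.H →L[ℂ] ρ.H) ∞

instance RepProduct.normedRing (p : StarPoly) : NormedRing (RepProduct p) :=
  inferInstanceAs (NormedRing (lp (fun ρ : HilbertRep p => ρ.H →L[ℂ] ρ.H) ∞))

instance RepProduct.starRing (p : StarPoly) : StarRing (RepProduct p) :=
  inferInstanceAs (StarRing (lp (fun ρ : HilbertRep p => ρ.H →L[ℂ] ρ.H) ∞))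

instance RepProduct.completeSpace (p : StarPoly) : CompleteSpace (RepProduct p) :=
  inferInstanceAs (CompleteSpace (lp (fun ρ : HilbertRep p => ρ.H →L[ℂ] ρ.H) ∞))

instance RepProduct.cstarRing (p : StarPoly) : CStarRing (RepProduct p) :=
  inferInstanceAs (CStarRing (lp (fun ρ : HilbertRep p => ρ.H →L[ℂ] ρ.H) ∞))

instance RepProduct.normedAlgebra (p : StarPoly) : NormedAlgebra ℂ (RepProduct p) :=
  inferInstanceAs (NormedAlgebra ℂ (lp (fun ρ : HilbertRep p => ρ.H →L[ℂ] ρ.H) ∞))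

instance RepProduct.starModule (p : StarPoly) : StarModule ℂ (RepProduct p) :=
  inferInstanceAs (StarModule ℂ (lp (fun ρ : HilbertRep p => ρ.H →L[ℂ] ρ.H) ∞))

instance RepProduct.cstarAlgebra (p : StarPoly) : CStarAlgebra (RepProduct p) where

/-- The component of a bounded family at a representation, as a *-homomorphism. -/
def RepProduct.proj {p : StarPoly} (ρ : HilbertRep p) : RepProduct p →⋆ₐ[ℂ] (ρ.H →L[ℂ] ρ.H) where
  toFun a := a.1 ρ
  map_one' := rfl
  map_mul' _ _ := rfl
  map_zero' := rfl
  map_add' _ _ := rfl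
  commutes' _ := rfl
  map_star' _ := rfl

/-- The family `(T_ρ)` of all operators that satisfy the relation. -/
def repGen (p : StarPoly) (hp : IsBoundedRel p) : RepProduct p :=
  ⟨fun ρ => ρ.op, by
    obtain ⟨C, hC⟩ := hp
    exact memℓp_infty ⟨C, by rintro _ ⟨ρ, rfl⟩; exact hC ρ⟩⟩

/-- The universal unital C*-algebra generated by `z` and `z̄ = z*` with the relation
`p(z, z̄) = 0`: the completion of the polynomials in `z, z̄`, modulo the null space, for the
seminorm `a ↦ sup ‖π(a)‖` over all Hilbert space representations `π` of the relation. Since the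
polynomials modulo the null space embed isometrically in the product over all
representations (see `norm_eval_gen`), the completion is the closed *-subalgebra generated by the
family of all representing operators. -/
def UniversalCStar (p : StarPoly) (hp : IsBoundedRel p) : Type 1 :=
  StarAlgebra.elemental ℂ (repGen p hp)

instance UniversalCStar.cstarAlgebra (p : StarPoly) (hp : IsBoundedRel p) :
    CStarAlgebra (UniversalCStar p hp) :=
  inferInstanceAs (CStarAlgebra (StarAlgebra.elemental ℂ (repGen p hp)))

/-- The inclusion in the product over all representations. -/
def UniversalCStar.incl (p : StarPoly) (hp : IsBoundedRel p) :
    UniversalCStar p hp →⋆ₐ[ℂ] RepProduct p :=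
  (StarAlgebra.elemental ℂ (repGen p hp)).subtype

theorem UniversalCStar.norm_incl (p : StarPoly) (hp : IsBoundedRel p) (a : UniversalCStar p hp) :
    ‖UniversalCStar.incl p hp a‖ = ‖a‖ := rfl

/-- The canonical generator. -/
def UniversalCStar.gen (p : StarPoly) (hp : IsBoundedRel p) : UniversalCStar p hp :=
  ⟨repGen p hp, StarAlgebra.elemental.self_mem ℂ _⟩

section universal

variable {p : StarPoly} (hp : IsBoundedRel p)

/-- The representation of the universal algebra that belongs to a representation of the
relation. -/
def UniversalCStar.toRep (ρ : HilbertRep p) : UniversalCStar p hp →⋆ₐ[ℂ] (ρ.H →L[ℂ] ρ.H) :=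
  (RepProduct.proj ρ).comp (UniversalCStar.incl p hp)

@[simp] theorem UniversalCStar.toRep_gen (ρ : HilbertRep p) :
    UniversalCStar.toRep hp ρ (UniversalCStar.gen p hp) = ρ.op := rfl

theorem StarPoly.map_eval {A B : Type*} [Ring A] [StarRing A] [Algebra ℂ A] [Ring B] [StarRing B]
    [Algebra ℂ B] (φ : A →⋆ₐ[ℂ] B) (x : A) (q : StarPoly) :
    φ (StarPoly.eval x q) = StarPoly.eval (φ x) q := by
  have h : (φ : A →ₐ[ℂ] B).comp (StarPoly.eval x) = StarPoly.eval (φ x) := by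
    apply FreeAlgebra.hom_ext
    funext b
    cases b <;> simp [StarPoly.eval, map_star]
  exact DFunLike.congr_fun h q

theorem UniversalCStar.toRep_eval (ρ : HilbertRep p) (q : StarPoly) :
    UniversalCStar.toRep hp ρ (StarPoly.eval (UniversalCStar.gen p hp) q)
      = StarPoly.eval ρ.op q := by
  rw [StarPoly.map_eval, UniversalCStar.toRep_gen]

/-- The norm of a polynomial in the generator is the supremum of the norms over all Hilbert space
representations. -/
theorem norm_eval_gen (q : StarPoly) :
    BddAbove (Set.range fun ρ : HilbertRep p => ‖StarPoly.eval ρ.op q‖) ∧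
    ‖StarPoly.eval (UniversalCStar.gen p hp) q‖
      = ⨆ ρ : HilbertRep p, ‖StarPoly.eval ρ.op q‖ := by
  have h : ∀ ρ : HilbertRep p, StarPoly.eval ρ.op q
      = (UniversalCStar.incl p hp (StarPoly.eval (UniversalCStar.gen p hp) q)).1 ρ :=
    fun ρ => (UniversalCStar.toRep_eval hp ρ q).symm
  simp only [h]
  exact ⟨memℓp_infty_iff.1 (UniversalCStar.incl p hp _).2, lp.norm_eq_ciSup _⟩

/-- The generator satisfies the relation. -/
theorem eval_gen_rel : StarPoly.eval (UniversalCStar.gen p hp) p = 0 := by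
  rw [← norm_eq_zero, (norm_eval_gen hp p).2]
  simp [HilbertRep.rel]

/-- The polynomials in the generator and its adjoint are dense. -/
theorem dense_eval_gen :
    Dense (Set.range (StarPoly.eval (UniversalCStar.gen p hp))) := by
  set S : Subalgebra ℂ (RepProduct p) := (StarPoly.eval (repGen p hp)).range with hS
  have hle : (StarAlgebra.adjoin ℂ {repGen p hp}).toSubalgebra ≤ S := by
    rw [StarAlgebra.adjoin_toSubalgebra]
    refine Algebra.adjoin_le ?_
    rintro x (hx | hx)
    · rw [Set.mem_singleton_iff] at hx
      exact ⟨StarPoly.z, by simp [hx]⟩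
    · rw [Set.star_singleton, Set.mem_singleton_iff] at hx
      exact ⟨StarPoly.zbar, by simp [hx]⟩
  have hcoe : ∀ q, UniversalCStar.incl p hp (StarPoly.eval (UniversalCStar.gen p hp) q)
      = StarPoly.eval (repGen p hp) q := fun q =>
    StarPoly.map_eval (UniversalCStar.incl p hp) (UniversalCStar.gen p hp) q
  have hind : Topology.IsInducing (UniversalCStar.incl p hp) :=
    (AddMonoidHomClass.isometry_of_norm (UniversalCStar.incl p hp)
      (UniversalCStar.norm_incl p hp)).isUniformInducing.isInducing
  intro a
  rw [hind.closure_eq_preimage_closure_image]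
  have ha : UniversalCStar.incl p hp a ∈ closure ((StarAlgebra.adjoin ℂ {repGen p hp} :
    StarSubalgebra ℂ (RepProduct p)) : Set (RepProduct p)) := a.2
  refine closure_mono ?_ ha
  intro x hx
  obtain ⟨q, hq⟩ := hle hx
  exact ⟨_, ⟨q, rfl⟩, (hcoe q).trans hq⟩

end universal

/-! ### The quantum disk -/

/-- The polynomial `[z̄, z] - μ (1 - z z̄) (1 - z̄ z)`. -/
def diskPoly (μ : ℝ) : StarPoly :=
  (StarPoly.zbar * StarPoly.z - StarPoly.z * StarPoly.zbar)
    - (μ : ℂ) • ((1 - StarPoly.z * StarPoly.zbar) * (1 - StarPoly.zbar * StarPoly.z))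

theorem eval_diskPoly {A : Type*} [Ring A] [StarRing A] [Algebra ℂ A] (μ : ℝ) (x : A) :
    StarPoly.eval x (diskPoly μ) = 0 ↔
      star x * x - x * star x = (μ : ℂ) • ((1 - x * star x) * (1 - star x * x)) := by
  rw [diskPoly, map_sub, map_smul, sub_eq_zero]
  simp only [map_sub, map_mul, map_one, StarPoly.eval_z, StarPoly.eval_zbar]

theorem isBoundedRel_diskPoly {μ : ℝ} (h0 : 0 < μ) (h1 : μ < 1) :
    IsBoundedRel (diskPoly μ) := by
  refine ⟨Real.sqrt ((1 + μ) / μ + 1 / (μ * (1 - μ))), fun ρ => Real.le_sqrt_of_sq_le ?_⟩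
  have hrel := (eval_diskPoly μ ρ.op).1 ρ.rel
  set T := ρ.op
  set a := star T * T with ha
  set b := T * star T with hb
  have hμ1 : 0 < 1 - μ := by linarith
  -- the relation, solved for `b`
  set d : ρ.H →L[ℂ] ρ.H := ((1 - μ : ℝ) : ℂ) • 1 + (μ : ℂ) • a with hd
  have hbd : b * d = (((1 + μ) / μ : ℝ) : ℂ) • d - ((1 / μ : ℝ) : ℂ) • 1 := by
    have hμ : (μ : ℂ) ≠ 0 := by exact_mod_cast h0.ne'
    have e1 : b * d = ((1 - μ : ℝ) : ℂ) • b + (μ : ℂ) • (b * a) := by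
      simp [hd, mul_add]
    have e2 : (μ : ℂ) • (b * a) = a - b - (μ : ℂ) • (1 - a - b) := by
      rw [hrel, ← smul_sub]
      congr 1
      noncomm_ring
    rw [e1, e2, hd]
    have e3 : (((1 + μ) / μ : ℝ) : ℂ) * ((1 - μ : ℝ) : ℂ) - ((1 / μ : ℝ) : ℂ) = -μ := by
      push_cast; field_simp; ring
    have e4 : (((1 + μ) / μ : ℝ) : ℂ) * (μ : ℂ) = 1 + μ := by
      push_cast; field_simp
    rw [smul_add, smul_smul, smul_smul, e4]
    rw [add_sub_right_comm, ← sub_smul, e3]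
    push_cast
    module
  -- `d` is bounded below
  have hinner : ∀ ξ : ρ.H, (1 - μ) * ‖ξ‖ ≤ ‖d ξ‖ := by
    intro ξ
    have h2 : (1 - μ) * ‖ξ‖ ^ 2 ≤ RCLike.re (inner ℂ ξ (d ξ)) := by
      have : inner ℂ ξ (d ξ) = ((1 - μ : ℝ) : ℂ) * inner ℂ ξ ξ + (μ : ℂ) * inner ℂ (T ξ) (T ξ) := by
        simp [hd, ha, ContinuousLinearMap.star_eq_adjoint,
          ContinuousLinearMap.adjoint_inner_right]
      rw [this, inner_self_eq_norm_sq_to_K, inner_self_eq_norm_sq_to_K]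
      have h3 : ((1 - μ : ℝ) : ℂ) * ((‖ξ‖ : ℂ)) ^ 2 + (μ : ℂ) * ((‖T ξ‖ : ℂ)) ^ 2
          = (((1 - μ) * ‖ξ‖ ^ 2 + μ * ‖T ξ‖ ^ 2 : ℝ) : ℂ) := by push_cast; ring
      have h4 : RCLike.re (((1 - μ : ℝ) : ℂ) * ((‖ξ‖ : ℂ)) ^ 2 + (μ : ℂ) * ((‖T ξ‖ : ℂ)) ^ 2)
          = (1 - μ) * ‖ξ‖ ^ 2 + μ * ‖T ξ‖ ^ 2 := by rw [h3]; exact Complex.ofReal_re _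
      refine le_trans ?_ h4.ge
      have : 0 ≤ μ * ‖T ξ‖ ^ 2 := by positivity
      linarith
    have h5 : RCLike.re (inner ℂ ξ (d ξ)) ≤ ‖ξ‖ * ‖d ξ‖ := re_inner_le_norm _ _
    rcases (norm_nonneg ξ).eq_or_lt with h | h
    · rw [← h]; simp
    · nlinarith
  have hunit : IsUnit d := by
    have hns : ¬ (-((1 - μ) / μ) : ℝ) ∈ spectrum ℝ a := fun hm => by
      have := spectrum_star_mul_self_nonneg (b := T) _ hm
      have : 0 < (1 - μ) / μ := by positivity
      linarith
    rw [spectrum.notMem_iff] at hns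
    have : d = ((-μ : ℝ)) • (algebraMap ℝ (ρ.H →L[ℂ] ρ.H) (-((1 - μ) / μ)) - a) := by
      rw [Algebra.algebraMap_eq_smul_one, smul_sub, smul_smul]
      have : -μ * -((1 - μ) / μ) = 1 - μ := by field_simp
      rw [this, hd, Complex.coe_smul, Complex.coe_smul]
      module
    rw [this]
    exact (isUnit_smul_iff (Units.mk0 (-μ) (by linarith)) _).2 hns
  obtain ⟨u, hu⟩ := hunit
  have hC : ‖b‖ ≤ (1 + μ) / μ + 1 / (μ * (1 - μ)) := by
    refine ContinuousLinearMap.opNorm_le_bound _ (by positivity) fun η => ?_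
    obtain ⟨ξ, rfl⟩ : ∃ ξ, d ξ = η := by
      refine ⟨(↑u⁻¹ : ρ.H →L[ℂ] ρ.H) η, ?_⟩
      rw [← hu, ← mul_apply_eq_comp, Units.mul_inv, one_apply_eq_self]
    have h6 : b (d ξ) = (((1 + μ) / μ : ℝ) : ℂ) • d ξ - ((1 / μ : ℝ) : ℂ) • ξ := by
      have := congrArg (fun S : ρ.H →L[ℂ] ρ.H => S ξ) hbd
      simpa using this
    have h7 : ‖ξ‖ ≤ ‖d ξ‖ / (1 - μ) := by
      rw [le_div_iff₀ hμ1]; linarith [hinner ξ]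
    rw [h6]
    refine (norm_sub_le _ _).trans ?_
    rw [norm_smul, norm_smul, Complex.norm_real, Complex.norm_real, Real.norm_of_nonneg
      (by positivity), Real.norm_of_nonneg (by positivity), add_mul]
    have h8 : 1 / (μ * (1 - μ)) * ‖d ξ‖ = 1 / μ * (‖d ξ‖ / (1 - μ)) := by field_simp
    rw [h8]
    gcongr
  have h9 : ‖b‖ = ‖T‖ * ‖T‖ := CStarRing.norm_self_mul_star
  rw [sq, ← h9]
  exact hC

/-- The quantum unit disk `C(𝔻_μ)`, `0 < μ < 1`: the universal unital C*-algebra generated by `z`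
and its adjoint `z̄` with the relation `[z̄, z] = μ (1 - z z̄) (1 - z̄ z)`. -/
abbrev QDisk (μ : Set.Ioo (0 : ℝ) 1) : Type 1 :=
  UniversalCStar (diskPoly μ) (isBoundedRel_diskPoly μ.2.1 μ.2.2)

/-! ### The Toeplitz algebra -/

/-- The polynomial `Ū U - 1`, for the generator `U`. -/
def isometryPoly : StarPoly := StarPoly.zbar * StarPoly.z - 1

theorem eval_isometryPoly {A : Type*} [Ring A] [StarRing A] [Algebra ℂ A] (x : A) :
    StarPoly.eval x isometryPoly = 0 ↔ star x * x = 1 := by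
  simp [isometryPoly, sub_eq_zero]

theorem isBoundedRel_isometryPoly : IsBoundedRel isometryPoly := by
  refine ⟨1, fun ρ => ?_⟩
  have h : ‖star ρ.op * ρ.op‖ = ‖ρ.op‖ * ‖ρ.op‖ := CStarRing.norm_star_mul_self
  rw [(eval_isometryPoly ρ.op).1 ρ.rel, norm_one] at h
  nlinarith [norm_nonneg ρ.op]

/-- The Toeplitz algebra `𝔗`: the universal unital C*-algebra generated by one element `U` with
the relation `U* U = 1`. -/
abbrev Toeplitz : Type 1 :=
  UniversalCStar isometryPoly isBoundedRel_isometryPoly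

end QuantumDisk

end

/-!
Polar decomposition is a bijection between the solutions `z` of the disk relation and the
isometries `u`, in every unital C*-algebra, and it is compatible with *-homomorphisms. Hence the two
universal algebras are isomorphic.

Put `x = 1 - z* z` and `y = 1 - z z*`. The relation reads `y - x = μ y x`, that is,
`y = x / (1 - μ x)`. Since `z* z` and `z z*` are positive with the same nonzero spectrum, this forces
`x ≥ 0` (`IsDisk.one_sub_nonneg`) and `z* z` invertible (`IsDisk.isUnit_star_mul_self`). So
`z = u h` with `h = (z* z)^(1/2)` and a unique isometry `u`.

Conversely, let `u` be an isometry and `Pₖ = uᵏ (1 - u u*) u*ᵏ`. If `z = u h` with `h ≥ 0` satisfies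
the relation, then `y = P₀ + u x u*`, and induction on `k` gives `Pₖ x = Pₖ / (1 + (k + 1) μ)`
(`IsPolarPair.gapProj_mul`). What is left of `x` on the range of `uⁿ` is `x / (1 + n μ x)`, carried
over by `uⁿ`, and tends to `0` in norm because `x ≥ 0`. Therefore `x` is the norm limit of
`∑ Pₖ / (1 + (k + 1) μ)`, and `u` determines `z` (`IsPolarPair.disk_unique`). This sum always
converges, by summation by parts, and defines a `z` for any given `u`
(`exists_isPolarPair_of_isometry`).

In `IsPolarPair μ z u`, which *-homomorphisms preserve, each of `z` and `u` thus determines the other.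
The homomorphism from the disk algebra sends its generator to the partner of the generator of the
Toeplitz algebra, and vice versa; both composites fix the generators by uniqueness.
-/

noncomputable section

open scoped CStarAlgebra

namespace QuantumDisk

/-! ### The universal property -/

/-- Restriction of families along a map of representations that keeps the Hilbert space. -/
def RepProduct.reindex {p q : StarPoly} (T : ∀ ρ : HilbertRep q, ρ.H →L[ℂ] ρ.H)
    (hT : ∀ ρ, StarPoly.eval (T ρ) p = 0) : RepProduct p →⋆ₐ[ℂ] RepProduct q where
  toFun a := ⟨fun ρ => a.1 { H := ρ.H, op := T ρ, rel := hT ρ }, by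
    obtain ⟨C, hC⟩ := memℓp_infty_iff.1 a.2
    exact memℓp_infty ⟨C, by rintro _ ⟨ρ, rfl⟩; exact hC ⟨_, rfl⟩⟩⟩
  map_one' := rfl
  map_mul' _ _ := rfl
  map_zero' := rfl
  map_add' _ _ := rfl
  commutes' _ := rfl
  map_star' _ := rfl

/-- The universal property, for targets that are themselves universal algebras. Each
representation of `q` turns `y` into an operator that satisfies `p`, so restriction of families
along this map of representations carries the family of the generators for `p` to `y`; no faithful
representation of the target has to be constructed. -/
theorem UniversalCStar.exists_hom {p q : StarPoly} (hp : IsBoundedRel p) (hq : IsBoundedRel q)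
    (y : UniversalCStar q hq) (hy : StarPoly.eval y p = 0) :
    ∃ φ : UniversalCStar p hp →⋆ₐ[ℂ] UniversalCStar q hq, φ (UniversalCStar.gen p hp) = y := by
  have hT : ∀ ρ : HilbertRep q, StarPoly.eval (UniversalCStar.toRep hq ρ y) p = 0 := fun ρ => by
    rw [← StarPoly.map_eval, hy, map_zero]
  set Θ := RepProduct.reindex _ hT with hΘ
  have hgen : Θ (repGen p hp) = UniversalCStar.incl q hq y := rfl
  have hmem : ∀ a : UniversalCStar p hp,
      Θ (UniversalCStar.incl p hp a) ∈ StarAlgebra.elemental ℂ (repGen q hq) := by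
    have hcl : IsClosed {a : UniversalCStar p hp |
        Θ (UniversalCStar.incl p hp a) ∈ StarAlgebra.elemental ℂ (repGen q hq)} :=
      (StarAlgebra.elemental.isClosed ℂ (repGen q hq)).preimage
        ((map_continuous Θ).comp (map_continuous (UniversalCStar.incl p hp)))
    intro a
    refine (dense_eval_gen hp).closure_eq.symm.subset.trans (hcl.closure_subset_iff.2 ?_)
      (Set.mem_univ a)
    rintro _ ⟨r, rfl⟩
    have : Θ (UniversalCStar.incl p hp (StarPoly.eval (UniversalCStar.gen p hp) r))
        = UniversalCStar.incl q hq (StarPoly.eval y r) := by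
      rw [StarPoly.map_eval, StarPoly.map_eval, StarPoly.map_eval]
      exact congrArg (fun x => StarPoly.eval x r) hgen
    rw [Set.mem_ofPred_eq, this]
    exact (StarPoly.eval y r).2
  exact ⟨StarAlgHom.codRestrict (Θ.comp (UniversalCStar.incl p hp)) _ hmem, rfl⟩

theorem UniversalCStar.hom_ext {p : StarPoly} {hp : IsBoundedRel p} {A : Type*} [CStarAlgebra A]
    {φ ψ : UniversalCStar p hp →⋆ₐ[ℂ] A}
    (h : φ (UniversalCStar.gen p hp) = ψ (UniversalCStar.gen p hp)) : φ = ψ := by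
  refine DFunLike.coe_injective ((map_continuous φ).ext_on (dense_eval_gen hp)
    (map_continuous ψ) ?_)
  rintro _ ⟨r, rfl⟩
  rw [StarPoly.map_eval, StarPoly.map_eval, h]

/-! ### The spectrum of a generator of the quantum disk -/

section Spectrum

variable {A : Type*} [CStarAlgebra A] {μ : ℝ} {z : A}

/-- The relation of the quantum disk, for an element of a C*-algebra. -/
def IsDisk (μ : ℝ) (z : A) : Prop :=
  star z * z - z * star z = μ • ((1 - z * star z) * (1 - star z * z))

theorem isDisk_iff_eval : IsDisk μ z ↔ StarPoly.eval z (diskPoly μ) = 0 := by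
  rw [eval_diskPoly, IsDisk, Complex.coe_smul]

theorem mem_spectrum_one_sub_iff {a : A} {r : ℝ} :
    r ∈ spectrum ℝ (1 - a) ↔ 1 - r ∈ spectrum ℝ a := by
  rw [spectrum.mem_iff, spectrum.mem_iff, not_iff_not, ← IsUnit.neg_iff]
  have : -(algebraMap ℝ A r - (1 - a)) = algebraMap ℝ A (1 - r) - a := by
    rw [map_sub, map_one]; abel
  rw [this]

/-- The relation, solved for `1 - z z*`: it is `f (1 - z* z)` for `f t = t / (1 - μ t)`. -/
theorem IsDisk.exists_unit_sub_mul (hz : IsDisk μ z) (h0 : 0 < μ) (h1 : μ < 1) :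
    ∃ d : Aˣ, ∀ r : ℝ, (algebraMap ℝ A r - (1 - z * star z)) * d
      = algebraMap ℝ A r - (1 + μ * r) • (1 - star z * z) := by
  have hns : (1 / μ : ℝ) ∉ spectrum ℝ (1 - star z * z) := fun hm => by
    rw [mem_spectrum_one_sub_iff] at hm
    have h2 := spectrum_star_mul_self_nonneg (b := z) _ hm
    have : 1 < 1 / μ := (one_lt_div h0).2 h1
    linarith
  have hyx : (1 - z * star z) - (1 - star z * z)
      = μ • ((1 - z * star z) * (1 - star z * z)) := by rw [← hz]; abel
  generalize 1 - star z * z = x at *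
  generalize 1 - z * star z = y at *
  have hd : IsUnit (1 - μ • x) := by
    rw [spectrum.notMem_iff] at hns
    have h3 : 1 - μ • x = μ • (algebraMap ℝ A (1 / μ) - x) := by
      rw [Algebra.algebraMap_eq_smul_one, smul_sub, smul_smul, mul_one_div_cancel h0.ne', one_smul]
    rw [h3]
    exact (isUnit_smul_iff (Units.mk0 μ h0.ne') _).2 hns
  obtain ⟨d, hd⟩ := hd
  refine ⟨d, fun r => ?_⟩
  have h4 : y * (1 - μ • x) = x := by
    rw [mul_sub, mul_one, mul_smul_comm, ← hyx]; abel
  rw [hd, sub_mul, h4, Algebra.algebraMap_eq_smul_one, smul_mul_assoc, one_mul]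
  module

/-- The spectral mapping for `f t = t / (1 - μ t)`, written through its inverse function
`t ↦ t / (1 + μ t)`. -/
theorem IsDisk.mem_spectrum_iff (hz : IsDisk μ z) (h0 : 0 < μ) (h1 : μ < 1) {r : ℝ}
    (hr : 1 + μ * r ≠ 0) :
    r ∈ spectrum ℝ (1 - z * star z) ↔ r / (1 + μ * r) ∈ spectrum ℝ (1 - star z * z) := by
  obtain ⟨d, hd⟩ := hz.exists_unit_sub_mul h0 h1
  have key : algebraMap ℝ A r - (1 + μ * r) • (1 - star z * z)
      = (1 + μ * r) • (algebraMap ℝ A (r / (1 + μ * r)) - (1 - star z * z)) := by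
    rw [smul_sub _ (algebraMap ℝ A _), Algebra.algebraMap_eq_smul_one,
      Algebra.algebraMap_eq_smul_one, smul_smul,
      mul_div_cancel₀ _ hr]
  rw [spectrum.mem_iff, spectrum.mem_iff, not_iff_not, ← Units.isUnit_mul_units _ d, hd, key]
  exact isUnit_smul_iff (Units.mk0 (1 + μ * r) hr) _

/-- The pole of `t ↦ t / (1 + μ t)` is not a spectral value. -/
theorem IsDisk.one_add_mul_ne_zero (hz : IsDisk μ z) (h0 : 0 < μ) (h1 : μ < 1) {r : ℝ}
    (hr : r ∈ spectrum ℝ (1 - z * star z)) : 1 + μ * r ≠ 0 := by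
  intro h
  obtain ⟨d, hd⟩ := hz.exists_unit_sub_mul h0 h1
  refine hr ?_
  have hr0 : r ≠ 0 := by rintro rfl; simp at h
  rw [spectrum.mem_resolventSet_iff, ← Units.isUnit_mul_units _ d, hd, h, zero_smul, sub_zero]
  exact (IsUnit.mk0 r hr0).map (algebraMap ℝ A)

/-- If `1 - z* z` had the spectral value `1`, then `1 - z z* ≤ 1` would have the spectral value
`1 / (1 - μ)`. -/
theorem IsDisk.isUnit_star_mul_self (hz : IsDisk μ z) (h0 : 0 < μ) (h1 : μ < 1) :
    IsUnit (star z * z) := by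
  by_contra h
  have h2 : (1 : ℝ) ∈ spectrum ℝ (1 - star z * z) := by
    rw [mem_spectrum_one_sub_iff, sub_self, spectrum.zero_mem_iff]
    exact h
  have h3 : 0 < 1 - μ := by linarith
  have h4 : 1 + μ * (1 / (1 - μ)) = 1 / (1 - μ) := by field_simp; ring
  have h5 : 0 < 1 / (1 - μ) := by positivity
  have h6 := (hz.mem_spectrum_iff h0 h1 (r := 1 / (1 - μ)) (by rw [h4]; exact h5.ne')).2
    (by rw [h4, div_self h5.ne']; exact h2)
  rw [mem_spectrum_one_sub_iff] at h6
  have h7 := spectrum_star_mul_self_nonneg (b := star z) _ (by rwa [star_star])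
  have : 1 < 1 / (1 - μ) := (one_lt_div h3).2 (by linarith)
  linarith

/-- A least spectral value `r < 0` of `1 - z* z` would also be one of `1 - z z*`, because
`z* z` and `z z*` have the same nonzero spectrum, and `r / (1 + μ r)` would be smaller still. -/
theorem IsDisk.one_sub_nonneg [PartialOrder A] [StarOrderedRing A] (hz : IsDisk μ z)
    (h0 : 0 < μ) (h1 : μ < 1) : 0 ≤ 1 - star z * z := by
  rw [nonneg_iff_isSelfAdjoint_and_quasispectrumRestricts]
  have hsa : IsSelfAdjoint (1 - star z * z) := .sub (.one A) (.star_mul_self z)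
  refine ⟨hsa, ?_⟩
  rw [quasispectrumRestricts_iff_spectrumRestricts, SpectrumRestricts.nnreal_iff]
  intro s hs
  obtain ⟨r, hr, hmin⟩ := (spectrum.isCompact (𝕜 := ℝ) (1 - star z * z)).exists_isLeast ⟨s, hs⟩
  refine le_trans ?_ (hmin hs)
  by_contra! hneg
  have hmem : r ∈ spectrum ℝ (1 - z * star z) := by
    rw [mem_spectrum_one_sub_iff] at hr ⊢
    have : 1 - r ∈ spectrum ℝ (star z * z) \ {0} := ⟨hr, by simp; linarith⟩
    rw [spectrum.nonzero_mul_comm] at this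
    exact this.1
  have hle : ∀ t ∈ spectrum ℝ (1 - star z * z), t ≤ 1 := fun t ht => by
    rw [mem_spectrum_one_sub_iff] at ht
    linarith [spectrum_star_mul_self_nonneg (b := z) _ ht]
  rcases lt_trichotomy (1 + μ * r) 0 with h | h | h
  · have h2 := hle _ ((hz.mem_spectrum_iff h0 h1 h.ne).1 hmem)
    rw [div_le_one_of_neg h] at h2
    nlinarith
  · exact hz.one_add_mul_ne_zero h0 h1 hmem h
  · have h2 := hmin ((hz.mem_spectrum_iff h0 h1 h.ne').1 hmem)
    rw [le_div_iff₀ h] at h2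
    nlinarith [mul_pos h0 (mul_pos_of_neg_of_neg hneg hneg)]

end Spectrum

/-! ### Range projections of the powers of an isometry -/

section RangeProj

variable {A : Type*} [CStarAlgebra A] {u : A}

/-- For an isometry `u`, the projection `uⁿ u*ⁿ` on the range of `uⁿ`. -/
def rangeProj (u : A) (n : ℕ) : A := u ^ n * star u ^ n

@[simp] theorem rangeProj_zero : rangeProj u 0 = 1 := by simp [rangeProj]

theorem rangeProj_succ (n : ℕ) : rangeProj u (n + 1) = u * rangeProj u n * star u := by
  rw [rangeProj, pow_succ', pow_succ, rangeProj]; simp only [mul_assoc]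

@[simp] theorem star_rangeProj (n : ℕ) : star (rangeProj u n) = rangeProj u n := by
  simp [rangeProj]

theorem star_pow_mul_pow (hu : star u * u = 1) (n : ℕ) : star u ^ n * u ^ n = 1 := by
  induction n with
  | zero => simp
  | succ n ih =>
    rw [pow_succ, pow_succ', mul_assoc, ← mul_assoc (star u), hu, one_mul, ih]

theorem rangeProj_mul_of_le (hu : star u * u = 1) {m n : ℕ} (h : m ≤ n) :
    rangeProj u m * rangeProj u n = rangeProj u n := by
  obtain ⟨k, rfl⟩ := Nat.exists_eq_add_of_le h
  rw [rangeProj, rangeProj, pow_add u m k, mul_assoc, mul_assoc (u ^ m), ← mul_assoc (star u ^ m),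
    star_pow_mul_pow hu, one_mul]

theorem rangeProj_mul (hu : star u * u = 1) (m n : ℕ) :
    rangeProj u m * rangeProj u n = rangeProj u (max m n) := by
  rcases le_total m n with h | h
  · rw [max_eq_right h, rangeProj_mul_of_le hu h]
  · rw [max_eq_left h]
    simpa using congrArg star (rangeProj_mul_of_le hu h)

theorem norm_one_le_one : ‖(1 : A)‖ ≤ 1 := by
  nontriviality A
  exact CStarRing.norm_one.le

theorem norm_pow_le_one (hu : star u * u = 1) (n : ℕ) : ‖u ^ n‖ ≤ 1 := by
  have h : ‖star (u ^ n) * u ^ n‖ = ‖u ^ n‖ * ‖u ^ n‖ := CStarRing.norm_star_mul_self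
  rw [star_pow, star_pow_mul_pow hu] at h
  nlinarith [norm_nonneg (u ^ n), norm_one_le_one (A := A)]

theorem norm_pow_mul_mul_star_pow_le (hu : star u * u = 1) (n : ℕ) (x : A) :
    ‖u ^ n * x * star u ^ n‖ ≤ ‖x‖ := by
  have h1 := norm_pow_le_one hu n
  have h2 : ‖star u ^ n‖ ≤ 1 := by rwa [← star_pow, norm_star]
  calc ‖u ^ n * x * star u ^ n‖ ≤ ‖u ^ n‖ * ‖x‖ * ‖star u ^ n‖ :=
        (norm_mul_le _ _).trans (by gcongr; exact norm_mul_le _ _)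
    _ ≤ 1 * ‖x‖ * 1 := by gcongr
    _ = ‖x‖ := by ring

theorem norm_rangeProj_le_one (hu : star u * u = 1) (n : ℕ) : ‖rangeProj u n‖ ≤ 1 := by
  simpa [rangeProj] using (norm_pow_mul_mul_star_pow_le hu n 1).trans norm_one_le_one

theorem rangeProj_nonneg [PartialOrder A] [StarOrderedRing A] (n : ℕ) : 0 ≤ rangeProj u n := by
  simpa [rangeProj] using mul_star_self_nonneg (u ^ n)

/-- The projection on the part of the range of `uⁿ` that is orthogonal to the range of
`uⁿ⁺¹`. -/
def gapProj (u : A) (n : ℕ) : A := rangeProj u n - rangeProj u (n + 1)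

theorem gapProj_succ (n : ℕ) : gapProj u (n + 1) = u * gapProj u n * star u := by
  rw [gapProj, rangeProj_succ n, rangeProj_succ (n + 1), gapProj, mul_sub, sub_mul]

@[simp] theorem star_gapProj (n : ℕ) : star (gapProj u n) = gapProj u n := by simp [gapProj]

theorem gapProj_mul_self (hu : star u * u = 1) (n : ℕ) :
    gapProj u n * gapProj u n = gapProj u n := by
  simp only [gapProj, sub_mul, mul_sub, rangeProj_mul hu, max_self]
  rw [max_eq_right (Nat.le_succ n), max_eq_left (Nat.le_succ n)]
  abel

theorem gapProj_mul_of_ne (hu : star u * u = 1) {m n : ℕ} (h : m ≠ n) :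
    gapProj u m * gapProj u n = 0 := by
  simp only [gapProj, sub_mul, mul_sub, rangeProj_mul hu]
  rcases h.lt_or_gt with h | h
  · rw [max_eq_right (by omega), max_eq_right (by omega), max_eq_right (by omega),
      max_eq_right (by omega)]
    abel
  · rw [max_eq_left (by omega), max_eq_left (by omega), max_eq_left (by omega),
      max_eq_left (by omega)]
    abel

theorem sum_gapProj (n : ℕ) : ∑ k ∈ Finset.range n, gapProj u k = 1 - rangeProj u n := by
  simp only [gapProj]
  rw [Finset.sum_range_sub', rangeProj_zero]

/-- The gap projections are orthogonal, so linear combinations multiply coefficientwise. -/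
theorem sum_smul_gapProj_mul (hu : star u * u = 1) (c d : ℕ → ℝ) (n : ℕ) :
    (∑ k ∈ Finset.range n, c k • gapProj u k) * (∑ k ∈ Finset.range n, d k • gapProj u k)
      = ∑ k ∈ Finset.range n, (c k * d k) • gapProj u k := by
  rw [Finset.sum_mul_sum]
  refine Finset.sum_congr rfl fun k hk => ?_
  rw [Finset.sum_eq_single_of_mem k hk fun j _ hj => by
    rw [smul_mul_smul_comm, gapProj_mul_of_ne hu hj.symm, smul_zero]]
  rw [smul_mul_smul_comm, gapProj_mul_self hu]

end RangeProj

/-! ### The weights -/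

/-- The eigenvalues `1, 1 / (1 + μ), 1 / (1 + 2 μ), …` of `1 - z z*` in the model in which `z` is
a weighted shift. -/
def weight (μ : ℝ) (n : ℕ) : ℝ := 1 / (1 + n * μ)

section Weight

variable {μ : ℝ}

@[simp] theorem weight_zero : weight μ 0 = 1 := by simp [weight]

theorem weight_pos (h0 : 0 < μ) (n : ℕ) : 0 < weight μ n := by unfold weight; positivity

theorem weight_sub_succ (h0 : 0 < μ) (n : ℕ) :
    weight μ n - weight μ (n + 1) = μ * (weight μ n * weight μ (n + 1)) := by
  unfold weight
  have h1 : (1 + n * μ) ≠ 0 := by positivity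
  have h2 : (1 + (n + 1 : ℕ) * μ) ≠ 0 := by positivity
  field_simp
  push_cast
  ring

theorem weight_succ_mul (h0 : 0 < μ) (n : ℕ) :
    weight μ (n + 1) * (1 + μ * weight μ n) = weight μ n := by
  linear_combination -weight_sub_succ h0 n

theorem weight_succ_le (h0 : 0 < μ) (n : ℕ) : weight μ (n + 1) ≤ weight μ n := by
  have := weight_sub_succ h0 n
  have := mul_pos h0 (mul_pos (weight_pos h0 n) (weight_pos h0 (n + 1)))
  linarith

theorem tendsto_weight (h0 : 0 < μ) : Filter.Tendsto (weight μ) Filter.atTop (nhds 0) := by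
  unfold weight
  simp only [one_div]
  exact (Filter.tendsto_atTop_add_const_left _ _
    (tendsto_natCast_atTop_atTop.atTop_mul_const h0)).inv_tendsto_atTop

theorem summable_weight_sub (h0 : 0 < μ) :
    Summable fun n => weight μ n - weight μ (n + 1) := by
  refine summable_of_sum_range_le (c := 1) (fun n => sub_nonneg.2 (weight_succ_le h0 n))
    fun n => ?_
  rw [Finset.sum_range_sub', weight_zero]
  linarith [weight_pos h0 n]

end Weight

/-! ### Polar pairs: the generator of the quantum disk belonging to an isometry -/

section Polar

variable {A : Type*} [CStarAlgebra A] {μ : ℝ} {z u : A}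

/-- The partial sums of `1 - z* z` in the spectral decomposition with respect to the gap
projections of the polar part `u` of `z`. -/
def diskSum (μ : ℝ) (u : A) (n : ℕ) : A :=
  ∑ k ∈ Finset.range n, weight μ (k + 1) • gapProj u k

/-- Summation by parts turns the partial sums into those of an absolutely convergent series. -/
theorem diskSum_eq (n : ℕ) : diskSum μ u n
    = 1 - ∑ k ∈ Finset.range n, (weight μ k - weight μ (k + 1)) • rangeProj u k
      - weight μ n • rangeProj u n := by
  induction n with
  | zero => simp [diskSum]
  | succ n ih =>
    rw [diskSum, Finset.sum_range_succ, ← diskSum, ih, Finset.sum_range_succ, gapProj]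
    module

theorem summable_diskSum (h0 : 0 < μ) (hu : star u * u = 1) :
    Summable fun k => (weight μ k - weight μ (k + 1)) • rangeProj u k := by
  refine Summable.of_norm_bounded (summable_weight_sub h0) fun k => ?_
  rw [norm_smul, Real.norm_of_nonneg (sub_nonneg.2 (weight_succ_le h0 k))]
  exact mul_le_of_le_one_right (sub_nonneg.2 (weight_succ_le h0 k)) (norm_rangeProj_le_one hu k)

theorem tendsto_diskSum (h0 : 0 < μ) (hu : star u * u = 1) :
    Filter.Tendsto (diskSum μ u) Filter.atTop
      (nhds (1 - ∑' k, (weight μ k - weight μ (k + 1)) • rangeProj u k)) := by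
  have h1 := (summable_diskSum h0 hu).hasSum.tendsto_sum_nat
  have h2 : Filter.Tendsto (fun n => weight μ n • rangeProj u n) Filter.atTop (nhds 0) := by
    refine squeeze_zero_norm (fun n => ?_) (tendsto_weight h0)
    rw [norm_smul, Real.norm_of_nonneg (weight_pos h0 n).le]
    exact mul_le_of_le_one_right (weight_pos h0 n).le (norm_rangeProj_le_one hu n)
  simpa [funext (diskSum_eq (μ := μ) (u := u))] using (h1.const_sub 1).sub h2

/-- With `1 - z* z` approximated by `diskSum`, the element `1 - z z*` is approximated by the same
combination with the weights shifted by one. -/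
theorem one_sub_conj_diskSum (n : ℕ) :
    1 - u * (1 - diskSum μ u n) * star u
      = ∑ k ∈ Finset.range (n + 1), weight μ k • gapProj u k := by
  have h : u * diskSum μ u n * star u
      = ∑ k ∈ Finset.range n, weight μ (k + 1) • gapProj u (k + 1) := by
    rw [diskSum, Finset.mul_sum, Finset.sum_mul]
    exact Finset.sum_congr rfl fun k _ => by
      rw [mul_smul_comm, smul_mul_assoc, gapProj_succ]
  rw [Finset.sum_range_succ', ← h, weight_zero, one_smul, gapProj, rangeProj_succ]
  simp only [rangeProj_zero, mul_one, mul_sub, sub_mul]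
  abel

theorem diskSum_relation (h0 : 0 < μ) (hu : star u * u = 1) (n : ℕ) :
    (1 - u * (1 - diskSum μ u n) * star u) - diskSum μ u (n + 1)
      = μ • ((1 - u * (1 - diskSum μ u n) * star u) * diskSum μ u (n + 1)) := by
  rw [one_sub_conj_diskSum, diskSum, sum_smul_gapProj_mul hu, ← Finset.sum_sub_distrib,
    Finset.smul_sum]
  refine Finset.sum_congr rfl fun k _ => ?_
  rw [← sub_smul, smul_smul, weight_sub_succ h0]

variable [PartialOrder A] [StarOrderedRing A]

/-- `z` is a generator of the quantum disk with polar decomposition `z = u h`, where `u` is an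
isometry. -/
structure IsPolarPair (μ : ℝ) (z u : A) : Prop where
  isDisk : IsDisk μ z
  isometry : star u * u = 1
  exists_eq_mul : ∃ h, 0 ≤ h ∧ z = u * h

theorem IsPolarPair.map {B : Type*} [CStarAlgebra B] [PartialOrder B] [StarOrderedRing B]
    (h : IsPolarPair μ z u) (φ : A →⋆ₐ[ℂ] B) : IsPolarPair μ (φ z) (φ u) where
  isDisk := by
    have := congrArg φ (isDisk_iff_eval.1 h.isDisk)
    rwa [StarPoly.map_eval, map_zero, ← isDisk_iff_eval] at this
  isometry := by rw [← map_star, ← map_mul, h.isometry, map_one]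
  exists_eq_mul := by
    obtain ⟨x, hx, hz⟩ := h.exists_eq_mul
    exact ⟨φ x, map_nonneg φ hx, by rw [hz, map_mul]⟩

/-- The generator is `z = u h` with `h² = ∑ (wₖ - wₖ₊₁) uᵏ u*ᵏ`, where `wₖ` are the weights. -/
theorem exists_isPolarPair_of_isometry (h0 : 0 < μ) (hu : star u * u = 1) :
    ∃ z, IsPolarPair μ z u := by
  set a := ∑' k, (weight μ k - weight μ (k + 1)) • rangeProj u k with ha
  have hlim : Filter.Tendsto (diskSum μ u) Filter.atTop (nhds (1 - a)) := tendsto_diskSum h0 hu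
  have ha0 : 0 ≤ a := by
    refine CStarAlgebra.isClosed_nonneg.mem_of_tendsto
      (summable_diskSum h0 hu).hasSum.tendsto_sum_nat (.of_forall fun n => ?_)
    exact Finset.sum_nonneg fun k _ =>
      smul_nonneg (sub_nonneg.2 (weight_succ_le h0 k)) (rangeProj_nonneg k)
  set h := CFC.sqrt a with hh
  have hh0 : 0 ≤ h := CFC.sqrt_nonneg a
  have hsq : h * h = a := CFC.sqrt_mul_sqrt_self a
  have hst : star h = h := (IsSelfAdjoint.of_nonneg hh0).star_eq
  refine ⟨u * h, ?_, hu, h, hh0, rfl⟩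
  have h1 : star (u * h) * (u * h) = a := by
    rw [star_mul, hst, mul_assoc, ← mul_assoc (star u), hu, one_mul, hsq]
  have h2 : u * h * star (u * h) = u * a * star u := by
    rw [star_mul, hst, ← hsq]; simp only [mul_assoc]
  have hconj : Filter.Tendsto (fun n => 1 - u * (1 - diskSum μ u n) * star u) Filter.atTop
      (nhds (1 - u * a * star u)) := by
    simpa using (((hlim.const_sub 1).const_mul u).mul_const (star u)).const_sub 1
  have hlim' := hlim.comp (Filter.tendsto_add_atTop_nat 1)
  have hL := hconj.sub hlim'
  have hR := (hconj.mul hlim').const_smul μ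
  rw [IsDisk, h1, h2]
  have := tendsto_nhds_unique hL (hR.congr fun n => (diskSum_relation h0 hu n).symm)
  rw [← this]
  abel

/-- The modulus `h = (z* z)^(1/2)` is invertible, as `z* z` is, and `u = z h⁻¹`. -/
theorem IsDisk.exists_isPolarPair (hz : IsDisk μ z) (h0 : 0 < μ) (h1 : μ < 1) :
    ∃ u, IsPolarPair μ z u := by
  set h := CFC.sqrt (star z * z) with hh
  have hh0 : 0 ≤ h := CFC.sqrt_nonneg _
  have hsq : h * h = star z * z := CFC.sqrt_mul_sqrt_self _ (star_mul_self_nonneg z)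
  have hunit : IsUnit h := by
    rw [← isUnit_mul_self_iff, hsq]
    exact hz.isUnit_star_mul_self h0 h1
  obtain ⟨v, hv⟩ := hunit
  have hst : star h = h := (IsSelfAdjoint.of_nonneg hh0).star_eq
  have hvst : star (↑v⁻¹ : A) = ↑v⁻¹ := by
    have : star v = v := Units.ext (by rw [Units.coe_star, hv, hst])
    rw [← Units.coe_star_inv, this]
  refine ⟨z * ↑v⁻¹, hz, ?_, h, hh0, ?_⟩
  · rw [star_mul, hvst, mul_assoc, ← mul_assoc (star z), ← hsq, ← hv]
    simp
  · rw [← hv, mul_assoc, Units.inv_mul, mul_one]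

theorem IsPolarPair.eq_mul_sqrt (h : IsPolarPair μ z u) : z = u * CFC.sqrt (star z * z) := by
  obtain ⟨x, hx, hz⟩ := h.exists_eq_mul
  have h1 : star z * z = x * x := by
    rw [hz, star_mul, (IsSelfAdjoint.of_nonneg hx).star_eq, mul_assoc, ← mul_assoc (star u),
      h.isometry, one_mul]
  rw [h1, CFC.sqrt_mul_self x, ← hz]

theorem IsPolarPair.isometry_unique {u' : A} (h : IsPolarPair μ z u) (h' : IsPolarPair μ z u')
    (h0 : 0 < μ) (h1 : μ < 1) : u = u' := by
  have hunit : IsUnit (CFC.sqrt (star z * z)) :=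
    (CFC.isUnit_sqrt_iff _ (star_mul_self_nonneg z)).2 (h.isDisk.isUnit_star_mul_self h0 h1)
  exact hunit.mul_right_cancel (h.eq_mul_sqrt.symm.trans h'.eq_mul_sqrt)

theorem IsPolarPair.mul_star_self (h : IsPolarPair μ z u) :
    z * star z = u * (star z * z) * star u := by
  have hs : star (CFC.sqrt (star z * z)) = CFC.sqrt (star z * z) :=
    (IsSelfAdjoint.of_nonneg (CFC.sqrt_nonneg _)).star_eq
  have hsq := CFC.sqrt_mul_sqrt_self (star z * z) (star_mul_self_nonneg z)
  set x := CFC.sqrt (star z * z) with hx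
  have hz : z = u * x := h.eq_mul_sqrt
  rw [← hsq]
  nth_rewrite 1 [hz]
  nth_rewrite 1 [hz]
  rw [star_mul, hs]
  simp only [mul_assoc]

/-- The relation forces `1 - z* z` to act on each gap projection as the next weight. -/
theorem IsPolarPair.gapProj_mul (h : IsPolarPair μ z u) (h0 : 0 < μ) (n : ℕ) :
    gapProj u n * (1 - star z * z) = weight μ (n + 1) • gapProj u n := by
  have hu := h.isometry
  have hrel : (1 - z * star z) - (1 - star z * z)
      = μ • ((1 - z * star z) * (1 - star z * z)) := by rw [← h.isDisk]; abel
  have hy : 1 - z * star z = gapProj u 0 + u * (1 - star z * z) * star u := by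
    rw [h.mul_star_self, gapProj, rangeProj_succ, rangeProj_zero]
    noncomm_ring
  generalize 1 - star z * z = x at *
  generalize 1 - z * star z = y at *
  -- being an eigenvector of `1 - z z*` for one weight means being one of `1 - z* z` for the next
  have step : ∀ m, gapProj u m * y = weight μ m • gapProj u m →
      gapProj u m * x = weight μ (m + 1) • gapProj u m := fun m hm => by
    have h2 : weight μ m • gapProj u m - gapProj u m * x
        = μ • (weight μ m • (gapProj u m * x)) := by
      rw [← hm, ← mul_sub, hrel, mul_smul_comm, ← mul_assoc, hm, smul_mul_assoc]
    have h3 : (1 + μ * weight μ m) • (gapProj u m * x)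
        = (1 + μ * weight μ m) • (weight μ (m + 1) • gapProj u m) := by
      rw [smul_smul, mul_comm _ (weight μ (m + 1)), weight_succ_mul h0, add_smul, one_smul,
        ← smul_smul, ← h2]
      abel
    have h4 : (1 + μ * weight μ m) ≠ 0 := by
      have := weight_pos h0 m
      positivity
    exact (smul_right_injective A h4) h3
  refine step n ?_
  induction n with
  | zero =>
    have h5 : gapProj u 0 * u = 0 := by
      rw [gapProj, rangeProj_succ, rangeProj_zero, sub_mul, mul_one, mul_assoc, hu]
      simp
    rw [hy, mul_add, gapProj_mul_self hu, ← mul_assoc, ← mul_assoc, h5]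
    simp
  | succ n ih =>
    rw [hy, mul_add, gapProj_mul_of_ne hu n.succ_ne_zero, zero_add, gapProj_succ]
    calc u * gapProj u n * star u * (u * x * star u)
        = u * gapProj u n * (star u * u) * x * star u := by simp only [mul_assoc]
      _ = u * (gapProj u n * x) * star u := by rw [hu, mul_one]; simp only [mul_assoc]
      _ = _ := by rw [step n ih]; simp only [mul_smul_comm, smul_mul_assoc]

theorem IsPolarPair.one_sub_rangeProj_mul (h : IsPolarPair μ z u) (h0 : 0 < μ) (n : ℕ) :
    (1 - rangeProj u n) * (1 - star z * z) = diskSum μ u n := by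
  rw [← sum_gapProj, Finset.sum_mul, diskSum]
  exact Finset.sum_congr rfl fun k _ => h.gapProj_mul h0 k

theorem IsPolarPair.commute_rangeProj (h : IsPolarPair μ z u) (h0 : 0 < μ) (n : ℕ) :
    rangeProj u n * (1 - star z * z) = (1 - star z * z) * rangeProj u n := by
  have h1 := h.one_sub_rangeProj_mul h0 n
  have h2 := congrArg star h1
  have h3 : star (diskSum μ u n) = diskSum μ u n := by simp [diskSum, star_sum]
  have h4 : star (1 - star z * z) = 1 - star z * z := by simp
  rw [h3, ← h1, star_mul, h4, star_sub, star_one, star_rangeProj] at h2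
  generalize 1 - star z * z = x at *
  rw [mul_sub, sub_mul, one_mul, mul_one] at h2
  exact (sub_right_injective h2).symm

/-- For `x = 1 - z* z`, the compression `u*ⁿ x uⁿ` is `x / (1 + n μ x)`. -/
theorem IsPolarPair.sub_compression (h : IsPolarPair μ z u) (h0 : 0 < μ) (n : ℕ) :
    (1 - star z * z) - star u ^ n * (1 - star z * z) * u ^ n
      = (n * μ) • ((1 - star z * z) * (star u ^ n * (1 - star z * z) * u ^ n)) := by
  have hu := h.isometry
  have hcomm := h.commute_rangeProj h0
  have hrel : (1 - z * star z) - (1 - star z * z)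
      = μ • ((1 - z * star z) * (1 - star z * z)) := by rw [← h.isDisk]; abel
  have hy : star u * (1 - z * star z) = (1 - star z * z) * star u := by
    rw [h.mul_star_self, mul_sub, ← mul_assoc, ← mul_assoc, hu, sub_mul]
    simp
  generalize 1 - star z * z = x at *
  generalize 1 - z * star z = y at *
  have h1 : x - star u * x * u = μ • (x * (star u * x * u)) := by
    have := congrArg (fun w => star u * w * u) hrel
    simp only [mul_sub, sub_mul, mul_smul_comm, smul_mul_assoc, ← mul_assoc, hy] at this
    simpa only [mul_assoc, hu, mul_one] using this
  induction n with
  | zero => simp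
  | succ n ih =>
    have e1 : star u ^ (n + 1) * x * u ^ (n + 1) = star u ^ n * (star u * x * u) * u ^ n := by
      rw [pow_succ, pow_succ']; simp only [mul_assoc]
    have h2 : star u ^ n * x * u ^ n - star u ^ (n + 1) * x * u ^ (n + 1)
        = μ • ((star u ^ n * x * u ^ n) * (star u ^ (n + 1) * x * u ^ (n + 1))) := by
      rw [e1, ← sub_mul, ← mul_sub, h1]
      have e2 : star u ^ n * rangeProj u n = star u ^ n := by
        rw [rangeProj, ← mul_assoc, star_pow_mul_pow hu, one_mul]
      have e3 : star u ^ n * x * u ^ n * (star u ^ n * (star u * x * u) * u ^ n)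
          = star u ^ n * (x * (star u * x * u)) * u ^ n := by
        calc _ = star u ^ n * (x * rangeProj u n) * (star u * x * u) * u ^ n := by
              simp only [rangeProj, mul_assoc]
          _ = star u ^ n * rangeProj u n * x * (star u * x * u) * u ^ n := by
              rw [← hcomm]; simp only [mul_assoc]
          _ = _ := by rw [e2]; simp only [mul_assoc]
      rw [e3, mul_smul_comm, smul_mul_assoc]
    generalize star u ^ n * x * u ^ n = v at *
    generalize star u ^ (n + 1) * x * u ^ (n + 1) = w at *
    have h3 : v + (n * μ) • (x * v) = x := by rw [← ih]; abel
    have h4 : x - w - (n * μ) • (x * w) = μ • (x * w) := by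
      calc x - w - (n * μ) • (x * w)
          = (v - w) + (n * μ) • (x * (v - w)) := by
            nth_rewrite 1 [← h3]; rw [mul_sub, smul_sub]; abel
        _ = μ • ((v + (n * μ) • (x * v)) * w) := by
            rw [h2, mul_smul_comm, add_mul, smul_mul_assoc, ← mul_assoc]; module
        _ = μ • (x * w) := by rw [h3]
    rw [sub_eq_iff_eq_add] at h4
    rw [h4, ← add_smul]
    push_cast
    congr 1
    ring

/-- For `x ≥ 0`, the element `t x / (1 + t x)` has norm at most `2`. -/
theorem mul_norm_le_two {x w : A} (hx : 0 ≤ x) {t : ℝ} (ht : 0 ≤ t) (h : x - w = t • (x * w)) :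
    t * ‖w‖ ≤ 2 := by
  have hge : 1 ≤ 1 + t • x := le_add_of_nonneg_right (smul_nonneg ht hx)
  obtain ⟨d, hd⟩ := CStarAlgebra.isUnit_of_le 1 hge
  have hinv : ‖(↑d⁻¹ : A)‖ ≤ 1 := by
    have h1 : (↑d⁻¹ : A) ≤ 1 := CStarAlgebra.inv_le_one
      (by rwa [← Units.val_le_val, Units.val_one, hd])
    have h2 : 0 ≤ (↑d⁻¹ : A) := CFC.inv_nonneg_of_nonneg d (by rw [hd]; exact zero_le_one.trans hge)
    exact (CStarAlgebra.norm_le_one_iff_of_nonneg _ h2).2 h1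
  have h3 : t • w = 1 - ↑d⁻¹ := by
    have h4 : (d : A) * (t • w) = (d : A) * (1 - ↑d⁻¹) := by
      rw [mul_sub, Units.mul_inv, mul_one, hd, add_mul, one_mul, smul_mul_assoc, mul_smul_comm,
        ← h, ← smul_add]
      simp
    exact d.isUnit.mul_left_cancel h4
  calc t * ‖w‖ = ‖t • w‖ := by rw [norm_smul, Real.norm_of_nonneg ht]
    _ ≤ ‖(1 : A)‖ + ‖(↑d⁻¹ : A)‖ := by rw [h3]; exact norm_sub_le _ _
    _ ≤ 2 := by linarith [norm_one_le_one (A := A)]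

/-- The isometry determines `z* z`: the difference from the `n`-th partial sum is
`uⁿ (x / (1 + n μ x)) u*ⁿ` for `x = 1 - z* z`, which is of norm at most `2 / (n μ)`. -/
theorem IsPolarPair.tendsto_diskSum (h : IsPolarPair μ z u) (h0 : 0 < μ) (h1 : μ < 1) :
    Filter.Tendsto (diskSum μ u) Filter.atTop (nhds (1 - star z * z)) := by
  have hx : 0 ≤ 1 - star z * z := h.isDisk.one_sub_nonneg h0 h1
  rw [tendsto_iff_norm_sub_tendsto_zero]
  refine squeeze_zero' (.of_forall fun n => norm_nonneg _)
    (Filter.eventually_atTop.2 ⟨1, fun n hn => ?_⟩)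
    (tendsto_const_div_atTop_nhds_zero_nat (2 / μ))
  have hn0 : (0 : ℝ) < n := by exact_mod_cast hn
  have e1 : diskSum μ u n - (1 - star z * z)
      = -(u ^ n * (star u ^ n * (1 - star z * z) * u ^ n) * star u ^ n) := by
    rw [← h.one_sub_rangeProj_mul h0, sub_mul, one_mul]
    have : u ^ n * (star u ^ n * (1 - star z * z) * u ^ n) * star u ^ n
        = rangeProj u n * (1 - star z * z) * rangeProj u n := by
      simp only [rangeProj, mul_assoc]
    rw [this, h.commute_rangeProj h0, mul_assoc, rangeProj_mul h.isometry, max_self]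
    abel
  rw [e1, norm_neg, div_div, le_div_iff₀ (by positivity)]
  have h3 := mul_norm_le_two hx (by positivity) (h.sub_compression h0 n)
  have h4 := norm_pow_mul_mul_star_pow_le h.isometry n (star u ^ n * (1 - star z * z) * u ^ n)
  calc _ ≤ ‖star u ^ n * (1 - star z * z) * u ^ n‖ * (μ * n) := by gcongr
    _ ≤ 2 := by linarith

theorem IsPolarPair.disk_unique {z' : A} (h : IsPolarPair μ z u) (h' : IsPolarPair μ z' u)
    (h0 : 0 < μ) (h1 : μ < 1) : z = z' := by
  have h2 := tendsto_nhds_unique (h.tendsto_diskSum h0 h1) (h'.tendsto_diskSum h0 h1)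
  rw [h.eq_mul_sqrt, h'.eq_mul_sqrt, sub_right_injective h2]

end Polar

/-! ### The isomorphism with the Toeplitz algebra -/

theorem nonempty_qDisk_starAlgEquiv_toeplitz (μ : Set.Ioo (0 : ℝ) 1) :
    Nonempty (QDisk μ ≃⋆ₐ[ℂ] Toeplitz) := by
  obtain ⟨μ, h0, h1⟩ := μ
  set D := QDisk ⟨μ, h0, h1⟩ with hD
  let _ : PartialOrder D := CStarAlgebra.spectralOrder D
  have _ : StarOrderedRing D := CStarAlgebra.spectralOrderedRing D
  let _ : PartialOrder Toeplitz := CStarAlgebra.spectralOrder Toeplitz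
  have _ : StarOrderedRing Toeplitz := CStarAlgebra.spectralOrderedRing Toeplitz
  have hp := isBoundedRel_diskPoly h0 h1
  have hq := isBoundedRel_isometryPoly
  obtain ⟨u, hu⟩ := (isDisk_iff_eval.2 (eval_gen_rel hp)).exists_isPolarPair h0 h1
  obtain ⟨z, hz⟩ := exists_isPolarPair_of_isometry h0
    ((eval_isometryPoly _).1 (eval_gen_rel hq))
  obtain ⟨φ, hφ⟩ := UniversalCStar.exists_hom hp hq z (isDisk_iff_eval.1 hz.isDisk)
  obtain ⟨ψ, hψ⟩ := UniversalCStar.exists_hom hq hp u ((eval_isometryPoly _).2 hu.isometry)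
  refine ⟨StarAlgEquiv.ofStarAlgHom φ ψ (UniversalCStar.hom_ext ?_) (UniversalCStar.hom_ext ?_)⟩
  · have h2 := hz.map ψ
    rw [hψ] at h2
    change ψ (φ _) = _
    rw [hφ]
    exact h2.disk_unique hu h0 h1
  · have h2 := hu.map φ
    rw [hφ] at h2
    change φ (ψ _) = _
    rw [hψ]
    exact h2.isometry_unique hz h0 h1

end QuantumDisk

end

theorem mainTheorem7 :
    (∀ μ ν : Set.Ioo (0 : ℝ) 1,
      Nonempty (QuantumDisk.QDisk μ ≃⋆ₐ[ℂ] QuantumDisk.QDisk ν)) ∧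
    (∀ μ : Set.Ioo (0 : ℝ) 1,
      Nonempty (QuantumDisk.QDisk μ ≃⋆ₐ[ℂ] QuantumDisk.Toeplitz)) := by
  refine ⟨fun μ ν => ?_, QuantumDisk.nonempty_qDisk_starAlgEquiv_toeplitz⟩
  obtain ⟨e⟩ := QuantumDisk.nonempty_qDisk_starAlgEquiv_toeplitz μ
  obtain ⟨f⟩ := QuantumDisk.nonempty_qDisk_starAlgEquiv_toeplitz ν
  exact ⟨e.trans f.symm⟩
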